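/- Let $M$ be a smooth algebraic variety over $\mathbb{C}$ (a smooth, separated $\mathbb{C}$-scheme of finite type, not necessarily connected), let $Y\subseteq M$ be a smooth closed subvariety and let $Z\subseteq M$ be a closed subscheme. Let $f:\mathrm{Bl}_Y M\to M$ be the blow-up of $M$ along $Y$, with exceptional divisor $E=f^{-1}(Y)$. Let $r=\mathrm{ord}_Y\,\mathcal{I}_Z$ be the largest integer $n$ such that $(\mathcal{I}_Z)_\eta\subseteq\mathfrak{m}_{M,\eta}^{\,n}$ at the generic point $\eta$ of $Y$ (at every generic point, if $Y$ is reducible; if there is no largest such $n$, put $r=0$: the choice of $r$ then has no influence). Let the *weak transform* $\widetilde Z\subseteq\mathrm{Bl}_Y M$ be the closed subscheme with the residual ideal sheaf $\mathcal{I}_{\widetilde Z}=(\mathcal{I}_{f^{-1}(Z)}:\mathcal{I}_E^{\,r})$, and let the *strict transform* $\widehat Z\subseteq\mathrm{Bl}_Y M$ be the scheme-theoretic closure of $f^{-1}(Z\setminus Y)$. A *prime cycle associated to $\widetilde Z$* is an integral closed subscheme $V\subseteq\mathrm{Bl}_Y M$ whose generic point is an associated point of $\mathcal{O}_{\widetilde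 Z}$; in other words, over some affine open set meeting $V$ there is an embedding of $\mathcal{O}_V$ into $\mathcal{O}_{\widetilde Z}$ as modules over the structure sheaf of $\mathrm{Bl}_Y M$. Then: 1. $\widetilde Z=\widehat Z$ if and only if $E$ contains no prime cycle associated to $\widetilde Z$. 2. If $\widetilde Z=\widehat Z$, then for every integer $l>0$ the subschemes $lE$ (with ideal sheaf $\mathcal{I}_E^{\,l}$) and $\widehat Z$ are transverse, i.e. Tor-independent: $\mathcal{T}or_j(\mathcal{O}_{lE},\mathcal{O}_{\widehat Z})=0$ for all $j>0$. -/

import Mathlib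

open CategoryTheory

universe u

namespace BlowupTransforms

open AlgebraicGeometry

/-- The closed subscheme with ideal sheaf `E` is an effective Cartier divisor: locally the ideal is
generated by one nonzerodivisor. -/
def IsEffectiveCartier {X : Scheme.{u}} (E : X.IdealSheafData) : Prop :=
  ∀ x : X, ∃ U : X.affineOpens, x ∈ U.1 ∧
    ∃ a ∈ nonZeroDivisors Γ(X, U.1), E.ideal U = Ideal.span {a}

/-- `f : B ⟶ M` is the blow-up of `M` along the closed subscheme with ideal sheaf `I`: the inverse
image of this subscheme in `B` is an effective Cartier divisor, and every morphism `g : T ⟶ M` such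
that the inverse image of the subscheme in `T` is an effective Cartier divisor factors uniquely
through `f`. -/
structure IsBlowup {M B : Scheme.{u}} (f : B ⟶ M) (I : M.IdealSheafData) : Prop where
  isEffectiveCartier : IsEffectiveCartier (I.comap f)
  existsUnique_lift : ∀ {T : Scheme.{u}} (g : T ⟶ M), IsEffectiveCartier (I.comap g) →
    ∃! h : T ⟶ B, h ≫ f = g

/-- The stalk at `x` of the ideal sheaf `I` is contained in the `n`-th power of the maximal ideal of
the local ring at `x`. -/
def VanishesToOrder {X : Scheme.{u}} (I : X.IdealSheafData) (x : X) (n : ℕ) : Prop :=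
  ∀ (U : X.affineOpens) (hx : x ∈ U.1),
    (I.ideal U).map (X.presheaf.germ U.1 x hx).hom ≤
      IsLocalRing.maximalIdeal (X.presheaf.stalk x) ^ n

/-- The order `ord_Y I` of the ideal sheaf `I` along the closed subscheme `Y` with ideal sheaf `IY`:
the supremum of all `n` such that `I` is contained in the `n`-th power of the maximal ideal of the
local ring of the ambient scheme at (each) generic point of `Y`. It is `⊤` if there is no largest
such `n`. -/
noncomputable def orderAlong {X : Scheme.{u}} (IY I : X.IdealSheafData) : ℕ∞ :=
  sSup {n : ℕ∞ | ∃ m : ℕ, n = m ∧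
    ∀ y ∈ genericPoints IY.subscheme, VanishesToOrder I (IY.subschemeι y) m}

/-- The ideal sheaf `(J : K)`, the largest quasi-coherent ideal sheaf `L` with `L * K ≤ J`. -/
noncomputable def residual {X : Scheme.{u}} (J K : X.IdealSheafData) : X.IdealSheafData :=
  sSup {L | L * K ≤ J}

section Transforms

variable {M B : Scheme.{u}} (f : B ⟶ M) (IY IZ : M.IdealSheafData)

/-- The ideal sheaf of the exceptional divisor `E = f⁻¹(Y)`. -/
noncomputable abbrev exceptional : B.IdealSheafData := IY.comap f

/-- The ideal sheaf of the total transform `f⁻¹(Z)`. -/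
noncomputable abbrev totalTransform : B.IdealSheafData := IZ.comap f

/-- The ideal sheaf `(I_{f⁻¹(Z)} : I_E ^ r)` of the weak transform of `Z`, where `r = ord_Y I_Z`.
If `r` is infinite (for `M` a smooth variety this says that `Z` is everything near `Y`, so that the
total transform is everything near `E`), the exponent does not matter and is taken to be `0`. -/
noncomputable def weakTransform : B.IdealSheafData :=
  residual (totalTransform f IZ) (exceptional f IY ^ (orderAlong IY IZ).toNat)

/-- The ideal sheaf of the strict transform of `Z`: the scheme-theoretic closure in `B` of
`f⁻¹(Z ∖ Y)`, that is, of the complement of `E` in the total transform. -/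
noncomputable def strictTransform : B.IdealSheafData :=
  (((totalTransform f IZ).subschemeι ⁻¹ᵁ (exceptional f IY).support.compl).ι ≫
    (totalTransform f IZ).subschemeι).ker

end Transforms

/-- The closed subscheme `V` with ideal sheaf `IV` is a prime cycle associated to the structure sheaf
of the closed subscheme `W` with ideal sheaf `IW`: `V` is integral, and `𝒪_V` embeds in `𝒪_W` over
some affine open `U` which meets `V` (so the generic point of `V` is an associated point of `𝒪_W`).
-/
def IsAssociatedPrimeCycle {X : Scheme.{u}} (IV IW : X.IdealSheafData) : Prop :=
  IsIntegral IV.subscheme ∧ ∃ U : X.affineOpens, IV.ideal U ≠ ⊤ ∧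
    ∃ φ : (Γ(X, U.1) ⧸ IV.ideal U) →ₗ[Γ(X, U.1)] (Γ(X, U.1) ⧸ IW.ideal U),
      Function.Injective φ

/-- The closed subschemes with ideal sheaves `I` and `J` are Tor-independent: all sheaves
`Tor_j (𝒪_X / I, 𝒪_X / J)`, `j > 0`, vanish. These are quasi-coherent; over an affine open `U` they
are given by the Tor modules over the ring of sections. -/
def TorIndependent {X : Scheme.{u}} (I J : X.IdealSheafData) : Prop :=
  ∀ (U : X.affineOpens) (j : ℕ), 0 < j →
    Limits.IsZero (((Tor (ModuleCat.{u} Γ(X, U.1)) j).obj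
      (ModuleCat.of Γ(X, U.1) (Γ(X, U.1) ⧸ I.ideal U))).obj
      (ModuleCat.of Γ(X, U.1) (Γ(X, U.1) ⧸ J.ideal U)))

end BlowupTransforms

open AlgebraicGeometry BlowupTransforms

/-! Locally `E` is cut out by a nonzerodivisor `a`, and the strict transform is the `a`-saturation
of the total transform (`mem_ideal_ker_compl_iff`). It contains the weak ideal, whatever the
exponent `r`, and `a` is a nonzerodivisor modulo it.

Hence no prime containing `a` is associated to the strict transform. Conversely, a section in the
strict but not the weak ideal has nonzero class killed by a power of `a`; over a noetherian ring its
annihilator lies in an associated prime, which contains `a`, and the closure of that prime is a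
forbidden cycle in `E`.

For Tor, `I_E ^ l` is locally free, so `0 → K → A → A/K → 0` is a projective resolution and only
injectivity of `A/S ⊗ K → A/S` remains; this is regularity of `a` modulo `S`.

All this needs the blow-up to be locally noetherian, which is extracted from the universal property
alone (`IsBlowup.isNoetherianRing`). -/

namespace BlowupTransforms

open AlgebraicGeometry

/-! ### Tor from a two-term projective resolution -/

section Tor

open Limits HomologicalComplex

lemma down_rel_one_zero : (ComplexShape.down ℕ).Rel 1 0 := rfl

lemma doubleXIso_hom_comp {C : Type*} [Category* C] [Abelian C] {X Y : C} (f : X ⟶ Y) :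
    (doubleXIso₀ f down_rel_one_zero).hom ≫ f =
      (double f down_rel_one_zero).d 1 0 ≫
        (doubleXIso₁ f down_rel_one_zero one_ne_zero).hom := by
  simp [double_d f down_rel_one_zero one_ne_zero]

/-- A short exact sequence `0 ⟶ P₁ ⟶ P₀ ⟶ Z ⟶ 0` with `P₁`, `P₀` projective is a projective
resolution of `Z`. -/
noncomputable def shortProjectiveResolution {C : Type*} [Category* C] [Abelian C]
    (S : ShortComplex C) (hS : S.ShortExact) [Projective S.X₁] [Projective S.X₂] :
    ProjectiveResolution S.X₃ where
  complex := double S.f down_rel_one_zero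
  projective n := by
    match n with
    | 0 => exact Projective.of_iso (doubleXIso₁ S.f down_rel_one_zero one_ne_zero).symm inferInstance
    | 1 => exact Projective.of_iso (doubleXIso₀ S.f down_rel_one_zero).symm inferInstance
    | n + 2 =>
      exact Projective.of_iso
        (isZero_double_X S.f down_rel_one_zero _ (by omega) (by omega)).isoZero.symm inferInstance
  π := (ChainComplex.toSingle₀Equiv _ _).symm ⟨(doubleXIso₁ S.f down_rel_one_zero one_ne_zero).hom ≫ S.g, by
    simp [double_d S.f down_rel_one_zero one_ne_zero]⟩
  quasiIso := ⟨fun n => by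
    have := hS.mono_f
    have := hS.epi_g
    cases n with
    | zero =>
      rw [ChainComplex.quasiIsoAt₀_iff, ShortComplex.quasiIso_iff_of_zeros']
      · refine (ShortComplex.exact_and_epi_g_iff_of_iso ?_).2 ⟨hS.exact, inferInstance⟩
        exact ShortComplex.isoMk (doubleXIso₀ S.f down_rel_one_zero) (doubleXIso₁ S.f down_rel_one_zero one_ne_zero) (Iso.refl _)
          (doubleXIso_hom_comp S.f) (by
            simp
            exact (Category.comp_id _).symm)
      · exact double_d_eq_zero₀ S.f down_rel_one_zero _ _ zero_ne_one
      all_goals rfl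
    | succ n =>
      rw [quasiIsoAt_iff_exactAt' _ _ (ChainComplex.exactAt_succ_single_obj _ _)]
      cases n with
      | zero =>
        rw [exactAt_iff' _ 2 1 0 (by simp) (by simp)]
        refine (ShortComplex.exact_iff_mono _ ?_).2 ?_
        · exact (isZero_double_X S.f down_rel_one_zero _ (by omega) (by omega)).eq_of_src _ _
        · change Mono ((double S.f down_rel_one_zero).d 1 0)
          rw [double_d S.f down_rel_one_zero one_ne_zero]
          infer_instance
      | succ n =>
        exact ShortComplex.exact_of_isZero_X₂ _
          (isZero_double_X S.f down_rel_one_zero _ (by omega) (by omega))⟩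

/-- On the two-term resolution, degree 1 homology is the kernel of `F.map S.f`, and higher terms are
zero. -/
lemma isZero_leftDerived_of_mono {C D : Type*} [Category* C] [Category* D] [Abelian C] [Abelian D]
    [HasProjectiveResolutions C] (F : C ⥤ D) [F.Additive]
    (S : ShortComplex C) (hS : S.ShortExact) [Projective S.X₁] [Projective S.X₂]
    [Mono (F.map S.f)] (j : ℕ) (hj : 0 < j) :
    IsZero ((F.leftDerived j).obj S.X₃) := by
  refine IsZero.of_iso ?_ ((shortProjectiveResolution S hS).isoLeftDerivedObj F j)
  change IsZero (((F.mapHomologicalComplex _).obj (double S.f down_rel_one_zero)).homology j)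
  rw [← exactAt_iff_isZero_homology]
  match j, hj with
  | 1, _ =>
    rw [exactAt_iff' _ 2 1 0 (by simp) (by simp)]
    refine (ShortComplex.exact_iff_mono _ ?_).2 ?_
    · exact (F.map_isZero (isZero_double_X S.f down_rel_one_zero 2 (by omega)
        (by omega))).eq_of_src _ _
    · change Mono (F.map ((double S.f down_rel_one_zero).d 1 0))
      rw [double_d S.f down_rel_one_zero one_ne_zero, F.map_comp, F.map_comp]
      infer_instance
  | j + 2, _ =>
    exact ShortComplex.exact_of_isZero_X₂ _
      (F.map_isZero (isZero_double_X S.f down_rel_one_zero (j + 2) (by omega) (by omega)))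

/-- The kernel is `(S ⊓ K) / (S * K)`: every tensor is `1 ⊗ k`, and it vanishes once `k ∈ S • K`. -/
lemma lTensor_quotient_subtype_injective {A : Type*} [CommRing A] (S K : Ideal A)
    (h : S ⊓ K ≤ S * K) : Function.Injective (K.subtype.lTensor (A ⧸ S)) := by
  rw [injective_iff_map_eq_zero]
  intro t ht
  obtain ⟨k, rfl⟩ := TensorProduct.mk_surjective A K (A ⧸ S) Ideal.Quotient.mk_surjective t
  have hk : (k : A) ∈ S := by
    have := congrArg (TensorProduct.rid A (A ⧸ S)) ht
    simpa [Algebra.smul_def, Ideal.Quotient.eq_zero_iff_mem] using this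
  have hk' : k ∈ S • (⊤ : Submodule A K) := (Submodule.mem_smul_top_iff S K k).2 (h ⟨hk, k.2⟩)
  refine (Submodule.smul_le (P := LinearMap.ker (TensorProduct.mk A (A ⧸ S) K 1))).2 ?_ hk'
  intro s hs n _
  rw [LinearMap.mem_ker, map_smul, TensorProduct.mk_apply, TensorProduct.smul_tmul',
    Algebra.smul_def, mul_one]
  rw [show algebraMap A (A ⧸ S) s = 0 from Ideal.Quotient.eq_zero_iff_mem.2 hs,
    TensorProduct.zero_tmul]

lemma isZero_tor_quotient {A : Type u} [CommRing A] (S K : Ideal A) [Module.Projective A K]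
    (h : S ⊓ K ≤ S * K) (j : ℕ) (hj : 0 < j) :
    IsZero (((Tor (ModuleCat.{u} A) j).obj (ModuleCat.of A (A ⧸ S))).obj
      (ModuleCat.of A (A ⧸ K))) := by
  let T : ShortComplex (ModuleCat.{u} A) :=
    ShortComplex.mk (ModuleCat.ofHom K.subtype) (ModuleCat.ofHom K.mkQ) (by
      ext x
      exact (Submodule.Quotient.mk_eq_zero K).2 x.2)
  have hT : T.ShortExact :=
    { exact := (ShortComplex.ShortExact.moduleCat_exact_iff_function_exact T).2 <|
        LinearMap.exact_subtype_mkQ K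
      mono_f := (ModuleCat.mono_iff_injective _).2 K.subtype_injective
      epi_g := (ModuleCat.epi_iff_surjective _).2 K.mkQ_surjective }
  have : Projective T.X₁ := ModuleCat.projective_of_categoryTheory_projective (ModuleCat.of A K)
  have : Projective T.X₂ := ModuleCat.projective_of_categoryTheory_projective (ModuleCat.of A A)
  let F := (MonoidalCategory.tensoringLeft (ModuleCat.{u} A)).obj (ModuleCat.of A (A ⧸ S))
  have : Mono (F.map T.f) :=
    (ModuleCat.mono_iff_injective _).2 (lTensor_quotient_subtype_injective S K h)
  exact isZero_leftDerived_of_mono F T hT j hj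

end Tor

/-! ### Ideal sheaves on affine charts -/

section Sheaf

variable {X Y : Scheme.{u}}

lemma mem_ideal_of_locally (I : X.IdealSheafData) (U : X.affineOpens) (x : Γ(X, U.1))
    (h : ∀ p ∈ U.1, ∃ (f : Γ(X, U.1)), p ∈ X.basicOpen f ∧
      X.presheaf.map (homOfLE (X.basicOpen_le f)).op x ∈ I.ideal (X.affineBasicOpen f)) :
    x ∈ I.ideal U := by
  choose! f hf hx using h
  have hs : Ideal.span (Set.range fun p : U.1 => f p) = ⊤ := by
    rw [← U.2.self_le_iSup_basicOpen_iff]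
    exact fun p hp => TopologicalSpace.Opens.mem_iSup.mpr ⟨⟨_, ⟨p, hp⟩, rfl⟩, hf p hp⟩
  have inst := U.2.isLocalization_basicOpen
  have key : Ideal.span {x} ≤ I.ideal U := by
    refine Submodule.le_of_isLocalized_span _ hs (fun i ↦ Γ(X, X.basicOpen i.1))
      (fun i ↦ Algebra.linearMap Γ(X, U.1) Γ(X, X.basicOpen i.1)) ?_
    rintro ⟨_, p, rfl⟩
    simp only [← Submodule.restrictScalars_localized' Γ(X, X.basicOpen (f p)),
      Ideal.localized'_eq_map, RingHom.algebraMap_toAlgebra]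
    erw [I.map_ideal (U := ⟨_, U.2.basicOpen _⟩) (X.basicOpen_le (f p))]
    rw [Ideal.map_span, Set.image_singleton, Submodule.restrictScalars_le,
      Ideal.span_singleton_le_iff_mem]
    exact hx p p.2
  exact key (Ideal.mem_span_singleton_self x)

/-- The ideal of global sections of an ideal sheaf on an affine scheme `Spec A`. -/
noncomputable def specIdeal {A : CommRingCat.{u}} (J : (Spec A).IdealSheafData) : Ideal A :=
  (J.ideal ⟨⊤, isAffineOpen_top _⟩).comap (Scheme.ΓSpecIso A).inv.hom

lemma specIdeal_le_iff {A : CommRingCat.{u}} {I J : (Spec A).IdealSheafData} :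
    specIdeal I ≤ specIdeal J ↔ I ≤ J := by
  have hs : Function.Surjective (Scheme.ΓSpecIso A).inv.hom :=
    (Scheme.ΓSpecIso A).symm.commRingCatIsoToRingEquiv.surjective
  rw [specIdeal, specIdeal, Ideal.comap_le_comap_iff_of_surjective _ hs]
  exact ⟨Scheme.IdealSheafData.le_of_isAffine, fun h => h _⟩

lemma exists_specIdeal_eq {A : CommRingCat.{u}} (K : Ideal A) :
    ∃ J : (Spec A).IdealSheafData, specIdeal J = K := by
  refine ⟨Scheme.IdealSheafData.ofIdealTop (K.comap (Scheme.ΓSpecIso A).hom.hom), ?_⟩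
  ext x
  simp [specIdeal]

lemma specIdeal_map {A R : CommRingCat.{u}} (φ : R ⟶ A) (J : (Spec A).IdealSheafData) :
    specIdeal (J.map (Spec.map φ)) = (specIdeal J).comap φ.hom := by
  rw [specIdeal, specIdeal, Scheme.IdealSheafData.ideal_map_of_isAffineHom, Ideal.comap_comap,
    Ideal.comap_comap]
  change Ideal.comap _ (J.ideal ⟨⊤, _⟩) = _
  congr 1
  rw [← CommRingCat.hom_comp, ← CommRingCat.hom_comp, Scheme.ΓSpecIso_inv_naturality]
  rfl

/-- Both inclusions follow from the adjunction between `comap` and `map`, since `map` is contraction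
of ideals. -/
lemma specIdeal_comap {A R : CommRingCat.{u}} (φ : R ⟶ A) (J : (Spec R).IdealSheafData) :
    specIdeal (J.comap (Spec.map φ)) = (specIdeal J).map φ.hom := by
  apply le_antisymm
  · obtain ⟨L, hL⟩ := exists_specIdeal_eq ((specIdeal J).map φ.hom)
    rw [← hL, specIdeal_le_iff, ← Scheme.IdealSheafData.le_map_iff_comap_le, ← specIdeal_le_iff,
      specIdeal_map, hL]
    exact Ideal.le_comap_map
  · rw [Ideal.map_le_iff_le_comap, ← specIdeal_map, specIdeal_le_iff]
    exact Scheme.IdealSheafData.le_map_comap _ _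

lemma specIdeal_comap_fromSpec (J : X.IdealSheafData) {U : X.Opens} (hU : IsAffineOpen U) :
    specIdeal (J.comap hU.fromSpec) = J.ideal ⟨U, hU⟩ := by
  have e : hU.fromSpec ''ᵁ ⊤ = U := by
    rw [Scheme.Hom.image_top_eq_opensRange, IsAffineOpen.opensRange_fromSpec]
  have hT : IsAffineOpen (hU.fromSpec ''ᵁ ⊤) := (isAffineOpen_top _).image_of_isOpenImmersion _
  have h : (Scheme.ΓSpecIso Γ(X, U)).inv ≫ (hU.fromSpec.appIso ⊤).inv =
      X.presheaf.map (homOfLE e.le).op := by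
    rw [Iso.comp_inv_eq, Scheme.Hom.appIso_hom', Scheme.Hom.map_appLE, Scheme.Hom.appLE,
      IsAffineOpen.fromSpec_app_self, Category.assoc, ← Functor.map_comp]
    exact (Category.comp_id _).symm.trans (congrArg _ (CategoryTheory.Functor.map_id _ _).symm)
  rw [specIdeal, Scheme.IdealSheafData.ideal_comap_of_isOpenImmersion, Ideal.comap_comap,
    ← CommRingCat.hom_comp, h]
  have key : ∀ (V : X.Opens) (hV : IsAffineOpen V) (e : V = U),
      (J.ideal ⟨V, hV⟩).comap (X.presheaf.map (homOfLE e.le).op).hom = J.ideal ⟨U, hU⟩ := by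
    rintro V hV rfl
    change Ideal.comap (X.presheaf.map (𝟙 _)).hom _ = _
    rw [X.presheaf.map_id]
    rfl
  exact key _ hT e

lemma ideal_comap_appLE (f : X ⟶ Y) (J : Y.IdealSheafData) (U : X.affineOpens)
    (V : Y.affineOpens) (h : U.1 ≤ f ⁻¹ᵁ V.1) :
    (J.comap f).ideal U = (J.ideal V).map (f.appLE V.1 U.1 h).hom := by
  rw [← specIdeal_comap_fromSpec _ U.2, ← specIdeal_comap_fromSpec _ V.2, ← specIdeal_comap,
    ← Scheme.IdealSheafData.comap_comp, ← Scheme.IdealSheafData.comap_comp,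
    IsAffineOpen.SpecMap_appLE_fromSpec _ V.2 U.2]

lemma isEffectiveCartier_spec {A : CommRingCat.{u}} (J : (Spec A).IdealSheafData) (a : A)
    (ha : a ∈ nonZeroDivisors A) (h : specIdeal J = Ideal.span {a}) : IsEffectiveCartier J := by
  intro x
  refine ⟨⟨⊤, isAffineOpen_top _⟩, trivial, (Scheme.ΓSpecIso A).inv a, ?_, ?_⟩
  · exact (MulEquivClass.map_nonZeroDivisors
      (Scheme.ΓSpecIso A).symm.commRingCatIsoToRingEquiv).le ⟨a, ha, rfl⟩
  · rw [← Set.image_singleton, ← Ideal.map_span (Scheme.ΓSpecIso A).inv.hom, ← h, specIdeal,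
      Ideal.map_comap_of_surjective]
    exact (Scheme.ΓSpecIso A).symm.commRingCatIsoToRingEquiv.surjective

lemma map_nonZeroDivisor_basicOpen (U : X.affineOpens) (f a : Γ(X, U.1))
    (ha : a ∈ nonZeroDivisors Γ(X, U.1)) :
    X.presheaf.map (homOfLE (X.basicOpen_le f)).op a ∈
      nonZeroDivisors Γ(X, X.basicOpen f) := by
  have := U.2.isLocalization_basicOpen f
  exact IsLocalization.map_nonZeroDivisors_le (Submonoid.powers f) Γ(X, X.basicOpen f)
    ⟨a, ha, rfl⟩

end Sheaf

/-! ### The blow-up is locally noetherian -/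

section Noetherian

variable {X Y : Scheme.{u}}

lemma ideal_basicOpen_span (E : X.IdealSheafData) (U : X.affineOpens) (f a : Γ(X, U.1))
    (h : E.ideal U = Ideal.span {a}) :
    E.ideal (X.affineBasicOpen f) =
      Ideal.span {X.presheaf.map (homOfLE (X.basicOpen_le f)).op a} := by
  rw [← E.map_ideal_basicOpen, h, Ideal.map_span, Set.image_singleton]

lemma IsEffectiveCartier.exists_le {E : X.IdealSheafData} (hE : IsEffectiveCartier E) (x : X)
    (W : X.Opens) (hx : x ∈ W) : ∃ U : X.affineOpens, x ∈ U.1 ∧ U.1 ≤ W ∧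
      ∃ a ∈ nonZeroDivisors Γ(X, U.1), E.ideal U = Ideal.span {a} := by
  obtain ⟨U, hxU, a, ha, hU⟩ := hE x
  obtain ⟨f, hf, hxf⟩ := U.2.exists_basicOpen_le ⟨x, hx⟩ hxU
  exact ⟨X.affineBasicOpen f, hxf, hf, _, map_nonZeroDivisor_basicOpen U f a ha,
    ideal_basicOpen_span E U f a hU⟩

/-- Otherwise `a ∈ a * p`, and cancelling `a` gives `1 ∈ p`. -/
lemma exists_mem_mul_notMem {R A : Type*} [CommRing R] [CommRing A] (ψ : R →+* A) (I : Ideal R)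
    (a : A) (ha : a ∈ nonZeroDivisors A) (h : I.map ψ = Ideal.span {a}) (p : Ideal A)
    (hp : p ≠ ⊤) : ∃ g ∈ I, ∃ u, ψ g = a * u ∧ u ∉ p := by
  by_contra! hc
  have hle : I.map ψ ≤ Ideal.span {a} * p := by
    rw [Ideal.map_le_iff_le_comap]
    intro g hg
    have : ψ g ∈ Ideal.span {a} := h ▸ Ideal.mem_map_of_mem ψ hg
    obtain ⟨u, hu⟩ := Ideal.mem_span_singleton.1 this
    rw [Ideal.mem_comap, hu]
    exact Ideal.mul_mem_mul (Ideal.mem_span_singleton_self a) (hc g hg u hu)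
  have : a ∈ Ideal.span {a} * p := hle (h ▸ Ideal.mem_span_singleton_self a)
  obtain ⟨z, hz, hza⟩ := Ideal.mem_span_singleton_mul.1 this
  have h1 : z = 1 := by
    refine (mul_cancel_left_mem_nonZeroDivisors ha).1 ?_
    rw [hza, mul_one]
  exact hp ((Ideal.eq_top_iff_one p).2 (h1 ▸ hz))

/-- Locally on the source, the exceptional divisor is cut out by an element of the ideal of the centre. -/
lemma exists_affineOpens_comap_eq_span (f : X ⟶ Y) (I : Y.IdealSheafData)
    (hI : IsEffectiveCartier (I.comap f)) (x : X) :
    ∃ (V : Y.affineOpens) (U : X.affineOpens) (h : U.1 ≤ f ⁻¹ᵁ V.1), x ∈ U.1 ∧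
      ∃ g ∈ I.ideal V, (f.appLE V.1 U.1 h) g ∈ nonZeroDivisors Γ(X, U.1) ∧
        (I.comap f).ideal U = Ideal.span {(f.appLE V.1 U.1 h) g} := by
  obtain ⟨V, hV, hfV⟩ := Y.isBasis_affineOpens.exists_subset_of_mem_open
    (Set.mem_univ (f x)) isOpen_univ
  obtain ⟨⟨V, hVa⟩, rfl⟩ : ∃ V' : Y.affineOpens, (V'.1 : Set Y) = V := by
    obtain ⟨V', h, rfl⟩ := hV
    exact ⟨⟨V', h⟩, rfl⟩
  obtain ⟨U, hxU, hUV, a, ha, hU⟩ := hI.exists_le x (f ⁻¹ᵁ V) hfV.1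
  obtain ⟨g, hg, u, hgu, hu⟩ := exists_mem_mul_notMem (f.appLE V U.1 hUV).hom (I.ideal ⟨V, hVa⟩)
    a ha (by rw [← hU, ideal_comap_appLE f I U ⟨V, hVa⟩ hUV])
    (U.2.primeIdealOf ⟨x, hxU⟩).asIdeal (U.2.primeIdealOf ⟨x, hxU⟩).2.ne_top
  have hxu : x ∈ X.basicOpen u := by
    have : U.2.primeIdealOf ⟨x, hxU⟩ ∈ U.2.fromSpec ⁻¹ᵁ X.basicOpen u := by
      rw [U.2.fromSpec_preimage_basicOpen]
      exact hu
    have h' : U.2.fromSpec (U.2.primeIdealOf ⟨x, hxU⟩) ∈ X.basicOpen u := this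
    rwa [U.2.fromSpec_primeIdealOf] at h'
  -- Where `u` is invertible, the image `a * u` of `g` generates the same ideal as `a`.
  refine ⟨⟨V, hVa⟩, X.affineBasicOpen u, (X.basicOpen_le u).trans hUV, hxu, g, hg, ?_⟩
  have hunit : IsUnit (X.presheaf.map (homOfLE (X.basicOpen_le u)).op u) :=
    RingedSpace.isUnit_res_basicOpen _ u
  have key : f.appLE V (X.basicOpen u) ((X.basicOpen_le u).trans hUV) g =
      X.presheaf.map (homOfLE (X.basicOpen_le u)).op a *
        X.presheaf.map (homOfLE (X.basicOpen_le u)).op u := by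
    rw [← map_mul]
    refine Eq.trans ?_ (congrArg _ hgu)
    exact congrArg (fun φ => φ.hom g) (f.appLE_map hUV (homOfLE (X.basicOpen_le u)).op).symm
  change f.appLE V (X.basicOpen u) _ g ∈ _ ∧ _ = Ideal.span {f.appLE V (X.basicOpen u) _ g}
  rw [key, Ideal.span_singleton_mul_right_unit hunit]
  exact ⟨mul_mem (map_nonZeroDivisor_basicOpen U u a ha) hunit.mem_nonZeroDivisors,
    ideal_basicOpen_span _ U u a hU⟩

/-- A finite type subalgebra of `A` in which the ideal generated by `I` is already principal. -/
lemma exists_finiteType_subalgebra {R A : Type*} [CommRing R] [IsNoetherianRing R] [CommRing A]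
    [Algebra R A] (I : Ideal R) (g : R) (hg : g ∈ I)
    (h : I.map (algebraMap R A) = Ideal.span {algebraMap R A g}) :
    ∃ S : Subalgebra R A, IsNoetherianRing S ∧
      I.map (algebraMap R S) = Ideal.span {algebraMap R S g} := by
  obtain ⟨s, rfl⟩ := IsNoetherian.noetherian I
  have hs : ∀ x ∈ s, ∃ u : A, algebraMap R A x = algebraMap R A g * u := fun x hx =>
    Ideal.mem_span_singleton.1 (h ▸ Ideal.mem_map_of_mem _ (Ideal.subset_span hx))
  choose! u hu using hs
  -- Adjoin the quotients `x / g` for generators `x` of `I`.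
  refine ⟨Algebra.adjoin R (u '' s), ?_, ?_⟩
  · exact isNoetherianRing_of_fg (Subalgebra.fg_def.2 ⟨_, s.finite_toSet.image u, rfl⟩)
  · apply le_antisymm
    · rw [Ideal.map_le_iff_le_comap]
      refine Ideal.span_le.2 fun x hx => Ideal.mem_span_singleton.2
        ⟨⟨u x, Algebra.subset_adjoin ⟨x, hx, rfl⟩⟩, Subtype.ext (hu x hx)⟩
    · rw [Ideal.span_singleton_le_iff_mem]
      exact Ideal.mem_map_of_mem _ hg

/-- With `S` the finite type subalgebra above, `Spec S ⟶ Y` lifts to `l : Spec S ⟶ X`. By uniqueness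
`U ⟶ Spec S ⟶ X` is the open immersion of `U`, so `U ⟶ Spec S` is locally of finite type over a
noetherian base. -/
lemma IsBlowup.isNoetherianRing [IsLocallyNoetherian Y] {f : X ⟶ Y} {I : Y.IdealSheafData}
    (hf : IsBlowup f I) (V : Y.affineOpens) (U : X.affineOpens) (h : U.1 ≤ f ⁻¹ᵁ V.1)
    (g : Γ(Y, V.1)) (hg : g ∈ I.ideal V) (hreg : (f.appLE V.1 U.1 h) g ∈ nonZeroDivisors Γ(X, U.1))
    (hspan : (I.comap f).ideal U = Ideal.span {(f.appLE V.1 U.1 h) g}) :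
    IsNoetherianRing Γ(X, U.1) := by
  have : IsNoetherianRing Γ(Y, V.1) := IsLocallyNoetherian.component_noetherian V
  algebraize [(f.appLE V.1 U.1 h).hom]
  rw [ideal_comap_appLE f I U V h] at hspan
  obtain ⟨S, hS, hSI⟩ := exists_finiteType_subalgebra (A := Γ(X, U.1)) (I.ideal V) g hg hspan
  let i : CommRingCat.of S ⟶ Γ(X, U.1) := CommRingCat.ofHom S.val.toRingHom
  let j : Γ(Y, V.1) ⟶ CommRingCat.of S := CommRingCat.ofHom (algebraMap _ S)
  have hji : j ≫ i = f.appLE V.1 U.1 h := rfl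
  have hj : IsEffectiveCartier (I.comap (Spec.map j ≫ V.2.fromSpec)) := by
    refine isEffectiveCartier_spec _ (j g) ?_ ?_
    · rw [mem_nonZeroDivisors_iff_right] at hreg ⊢
      intro x hx
      exact Subtype.ext (hreg x.1 (congrArg Subtype.val hx))
    · rw [Scheme.IdealSheafData.comap_comp, specIdeal_comap, specIdeal_comap_fromSpec I V.2]
      exact hSI
  have hU : IsEffectiveCartier (I.comap (U.2.fromSpec ≫ f)) := by
    refine isEffectiveCartier_spec _ _ hreg ?_
    rw [Scheme.IdealSheafData.comap_comp, specIdeal_comap_fromSpec _ U.2,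
      ideal_comap_appLE f I U V h, hspan]
  obtain ⟨l, hl, -⟩ := hf.existsUnique_lift _ hj
  have hil : Spec.map i ≫ l = U.2.fromSpec := by
    refine (hf.existsUnique_lift _ hU).unique ?_ rfl
    rw [Category.assoc, hl, ← Category.assoc, ← Spec.map_comp, hji,
      IsAffineOpen.SpecMap_appLE_fromSpec _ V.2 U.2]
  have : IsOpenImmersion (Spec.map i ≫ l) := hil ▸ IsAffineOpen.isOpenImmersion_fromSpec U.2
  have : LocallyOfFiniteType (Spec.map i) := locallyOfFiniteType_of_comp _ l
  have : IsNoetherianRing (CommRingCat.of S) := hS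
  have := LocallyOfFiniteType.isLocallyNoetherian (Spec.map i)
  exact isLocallyNoetherian_Spec.1 this

theorem IsBlowup.isLocallyNoetherian [IsLocallyNoetherian Y] {f : X ⟶ Y} {I : Y.IdealSheafData}
    (hf : IsBlowup f I) : IsLocallyNoetherian X := by
  choose V U h hx g hg hreg hspan using
    exists_affineOpens_comap_eq_span f I hf.isEffectiveCartier
  refine isLocallyNoetherian_of_affine_cover (S := U)
    (top_le_iff.1 fun x _ => TopologicalSpace.Opens.mem_iSup.2 ⟨x, hx x⟩) fun x => ?_
  exact hf.isNoetherianRing (V x) (U x) (h x) (g x) (hg x) (hreg x) (hspan x)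

end Noetherian

/-! ### Scheme-theoretic closures, saturation and residual ideals -/

section Transforms

variable {X Y : Scheme.{u}}

/-- Sections of the image inject into sections of the integral scheme `X`, over a preimage that is
nonempty by dominance. -/
lemma isIntegral_subscheme_ker (g : X ⟶ Y) [QuasiCompact g] [IsIntegral X] :
    IsIntegral g.ker.subscheme := by
  refine ⟨⟨g.toImage (Classical.arbitrary X)⟩, fun U hU => ?_⟩
  have hinj : Function.Injective (g.toImage.app U) :=
    TopCat.Presheaf.app_injective_of_stalkFunctor_map_injective (F := g.image.sheaf) g.toImage.c U
      fun x _ => g.stalkFunctor_toImage_injective x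
  obtain ⟨x, hx⟩ := (IsDominant.denseRange (f := g.toImage)).exists_mem_open U.2
    ⟨_, (Classical.arbitrary U).2⟩
  have : Nonempty (g.toImage ⁻¹ᵁ U) := ⟨⟨x, hx⟩⟩
  exact hinj.isDomain (g.toImage.app U).hom

lemma app_eq_zero_of_appLE_eq_zero (g : X ⟶ Y) (U : Y.Opens) (W : X.Opens) (h : W = g ⁻¹ᵁ U)
    (x : Γ(Y, U)) (hx : g.appLE U W h.le x = 0) : g.app U x = 0 := by
  subst h
  rwa [Scheme.Hom.app_eq_appLE]

lemma ideal_ker_quotient_fromSpec {U : X.Opens} (hU : IsAffineOpen U) (P : Ideal Γ(X, U))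
    [QuasiCompact (Spec.map (CommRingCat.ofHom (Ideal.Quotient.mk P)) ≫ hU.fromSpec)] :
    (Spec.map (CommRingCat.ofHom (Ideal.Quotient.mk P)) ≫ hU.fromSpec).ker.ideal ⟨U, hU⟩ = P := by
  set g := Spec.map (CommRingCat.ofHom (Ideal.Quotient.mk P)) ≫ hU.fromSpec with hg
  have htop : ⊤ = g ⁻¹ᵁ U := by
    rw [hg, Scheme.Hom.comp_preimage, IsAffineOpen.fromSpec_preimage_self]
    rfl
  have key : g.appLE U ⊤ htop.le =
      CommRingCat.ofHom (Ideal.Quotient.mk P) ≫ (Scheme.ΓSpecIso _).inv := by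
    simp_rw [hg]
    rw [Scheme.Hom.comp_appLE, IsAffineOpen.fromSpec_app_self, Category.assoc]
    refine Eq.trans (congrArg _ (Scheme.Hom.map_appLE _ _ _)) ?_
    rw [Scheme.ΓSpecIso_inv_naturality, Scheme.Hom.appTop, Scheme.Hom.app_eq_appLE]
    rfl
  have hinj : Function.Injective
      (Scheme.ΓSpecIso (CommRingCat.of (Γ(X, U) ⧸ P))).inv.hom :=
    (Scheme.ΓSpecIso (CommRingCat.of (Γ(X, U) ⧸ P))).symm.commRingCatIsoToRingEquiv.injective
  rw [Scheme.Hom.ker_apply]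
  ext x
  have h0 : g.appLE U ⊤ htop.le x = 0 ↔ x ∈ P := by
    rw [key]
    exact (map_eq_zero_iff _ hinj).trans Ideal.Quotient.eq_zero_iff_mem
  rw [← h0, RingHom.mem_ker]
  refine ⟨fun h => ?_, app_eq_zero_of_appLE_eq_zero g U ⊤ htop x⟩
  have : (g.app U) x = 0 := h
  rw [Scheme.Hom.appLE, CommRingCat.comp_apply, this, map_zero]

lemma le_ker_of_comap_eq_bot (g : X ⟶ Y) (E : Y.IdealSheafData) (h : E.comap g = ⊥) :
    E ≤ g.ker := by
  rw [← Scheme.IdealSheafData.map_bot, Scheme.IdealSheafData.le_map_iff_comap_le, h]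

lemma mem_support_iff_notMem_basicOpen (E : X.IdealSheafData) (U : X.affineOpens) (a : Γ(X, U.1))
    (hE : E.ideal U = Ideal.span {a}) (x : X) (hx : x ∈ U.1) :
    x ∈ E.support ↔ x ∉ X.basicOpen a := by
  rw [Scheme.IdealSheafData.mem_support_iff_of_mem hx, hE, Scheme.zeroLocus_span,
    Scheme.mem_zeroLocus_iff]
  simp

lemma map_homOfLE_eq_zero_iff (V W₁ W₂ : X.Opens) (h₁ : W₁ ≤ V) (x : Γ(X, V)) (h : W₁ = W₂) :
    X.presheaf.map (homOfLE h₁).op x = 0 ↔ X.presheaf.map (homOfLE (h ▸ h₁)).op x = 0 := by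
  subst h
  rfl

/-- Over `U`, the complement of `E` in `T` is the basic open set of `a`, so restriction to it is
localization at `a`, with kernel the `a`-power torsion. -/
lemma mem_ideal_ker_compl_iff [IsLocallyNoetherian X] (T E : X.IdealSheafData)
    (U : X.affineOpens) (a : Γ(X, U.1)) (hE : E.ideal U = Ideal.span {a}) (x : Γ(X, U.1)) :
    x ∈ ((T.subschemeι ⁻¹ᵁ E.support.compl).ι ≫ T.subschemeι).ker.ideal U ↔
      ∃ n : ℕ, a ^ n * x ∈ T.ideal U := by
  have : IsLocallyNoetherian T.subscheme :=
    LocallyOfFiniteType.isLocallyNoetherian T.subschemeι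
  have hT (y : Γ(X, U.1)) : y ∈ T.ideal U ↔ T.subschemeι.app U.1 y = 0 := by
    rw [← T.ker_subschemeι_app U, RingHom.mem_ker]
  set W := T.subschemeι ⁻¹ᵁ E.support.compl with hW
  have hbo : T.subscheme.basicOpen (T.subschemeι.app U.1 a) =
      W.ι ''ᵁ W.ι ⁻¹ᵁ T.subschemeι ⁻¹ᵁ U.1 := by
    rw [← Scheme.preimage_basicOpen, Scheme.Hom.image_preimage_eq_opensRange_inf,
      Scheme.Opens.opensRange_ι]
    ext z
    have hz := mem_support_iff_notMem_basicOpen E U a hE (T.subschemeι z)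
    constructor
    · intro h
      have hU := X.basicOpen_le a h
      exact ⟨fun h' => (hz hU).1 h' h, hU⟩
    · rintro ⟨h, hU⟩
      by_contra h'
      exact h ((hz hU).2 h')
  rw [Scheme.Hom.ker_apply, RingHom.mem_ker]
  have hx : ((W.ι ≫ T.subschemeι).app U.1).hom x = 0 ↔
      T.subscheme.presheaf.map (homOfLE (T.subscheme.basicOpen_le
        (T.subschemeι.app U.1 a))).op (T.subschemeι.app U.1 x) = 0 := by
    rw [Scheme.Hom.comp_app]
    exact (map_homOfLE_eq_zero_iff _ _ _ _ _ hbo).symm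
  rw [hx]
  have hUa : IsAffineOpen (T.subschemeι ⁻¹ᵁ U.1) := U.2.preimage _
  have := hUa.isLocalization_basicOpen (T.subschemeι.app U.1 a)
  change algebraMap Γ(T.subscheme, T.subschemeι ⁻¹ᵁ U.1) _ _ = 0 ↔ _
  rw [IsLocalization.map_eq_zero_iff (Submonoid.powers (T.subschemeι.app U.1 a))]
  simp only [hT, map_mul, map_pow]
  constructor
  · rintro ⟨⟨_, n, rfl⟩, h⟩
    exact ⟨n, h⟩
  · rintro ⟨n, h⟩
    exact ⟨⟨_, n, rfl⟩, h⟩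

lemma residual_mul_le (J K : X.IdealSheafData) : residual J K * K ≤ J := by
  intro U
  change (residual J K).ideal U * K.ideal U ≤ J.ideal U
  have : (residual J K).ideal U ≤ (J.ideal U).colon (K.ideal U : Set Γ(X, U.1)) := by
    rw [residual, Scheme.IdealSheafData.ideal_sSup, sSup_apply]
    refine iSup_le ?_
    rintro ⟨_, L, hL, rfl⟩ x hx
    exact Submodule.mem_colon.2 fun k hk => hL U (Ideal.mul_mem_mul hx hk)
  exact Ideal.mul_le.2 fun x hx k hk => Submodule.mem_colon.1 (this hx) k hk

lemma le_residual (J K : X.IdealSheafData) : J ≤ residual J K :=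
  le_sSup (a := J) (show J * K ≤ J from fun _ => Ideal.mul_le_left)

lemma IsEffectiveCartier.exists_basicOpen {E : X.IdealSheafData} (hE : IsEffectiveCartier E)
    (U : X.affineOpens) (x : X) (hx : x ∈ U.1) : ∃ f : Γ(X, U.1), x ∈ X.basicOpen f ∧
      ∃ a ∈ nonZeroDivisors Γ(X, X.basicOpen f),
        E.ideal (X.affineBasicOpen f) = Ideal.span {a} := by
  obtain ⟨V, hxV, a, ha, hV⟩ := hE x
  obtain ⟨f, g, hfg, hxf⟩ := exists_basicOpen_le_affine_inter U.2 V.2 x ⟨hx, hxV⟩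
  refine ⟨f, hxf, ?_⟩
  have hV' : ∃ b ∈ nonZeroDivisors Γ(X, (X.affineBasicOpen g).1),
      E.ideal (X.affineBasicOpen g) = Ideal.span {b} :=
    ⟨_, map_nonZeroDivisor_basicOpen V g a ha, ideal_basicOpen_span E V g a hV⟩
  have h : X.affineBasicOpen f = X.affineBasicOpen g := Subtype.ext hfg
  rw [← h] at hV'
  exact hV'

lemma IsEffectiveCartier.pow {E : X.IdealSheafData} (hE : IsEffectiveCartier E) (n : ℕ) :
    IsEffectiveCartier (E ^ n) := by
  intro x
  obtain ⟨U, hx, a, ha, hU⟩ := hE x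
  refine ⟨U, hx, a ^ n, pow_mem ha n, ?_⟩
  rw [Scheme.IdealSheafData.ideal_pow, Pi.pow_apply, hU, Ideal.span_singleton_pow]

lemma IsEffectiveCartier.exists_cover {E : X.IdealSheafData} (hE : IsEffectiveCartier E) :
    ∃ U : X → X.affineOpens, ⨆ x, (U x).1 = ⊤ ∧
      ∀ x, ∃ a ∈ nonZeroDivisors Γ(X, (U x).1), E.ideal (U x) = Ideal.span {a} := by
  choose U hU h using hE
  exact ⟨U, top_le_iff.1 fun x _ => TopologicalSpace.Opens.mem_iSup.2 ⟨x, hU x⟩, h⟩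

end Transforms

/-! ### Comparison of weak and strict transforms -/

section Main

variable {X Y : Scheme.{u}}

lemma flat_of_locally_span_singleton {A : Type*} [CommRing A] (K : Ideal A) (s : Set A)
    (hs : Ideal.span s = ⊤) (C : s → Type*) [∀ r, CommRing (C r)] [∀ r, Algebra A (C r)]
    [∀ r, IsLocalization.Away r.1 (C r)]
    (h : ∀ r, ∃ a ∈ nonZeroDivisors (C r), K.map (algebraMap A (C r)) = Ideal.span {a}) :
    Module.Flat A K := by
  refine Module.flat_of_isLocalized_span A K s hs
    (fun r => Submodule.localized' (C r) (Submonoid.powers r.1) (Algebra.linearMap A (C r)) K)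
    (fun r => Submodule.toLocalized' (C r) (Submonoid.powers r.1) (Algebra.linearMap A (C r)) K)
    fun r => ?_
  obtain ⟨a, ha, hK⟩ := h r
  rw [Ideal.localized'_eq_map, hK]
  have hinj : Function.Injective (LinearMap.toSpanSingleton (C r) (C r) a) := by
    intro x y hxy
    exact (mul_cancel_right_mem_nonZeroDivisors ha).1 hxy
  have e : C r ≃ₗ[C r] Ideal.span {a} :=
    (LinearEquiv.ofInjective _ hinj).trans
      (LinearEquiv.ofEq _ _ (LinearMap.range_toSpanSingleton a))
  have : Module.Flat (C r) (Ideal.span {a}) := Module.Flat.of_linearEquiv e.symm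
  have : Module.Flat A (C r) := IsLocalization.flat (C r) (Submonoid.powers r.1)
  exact Module.Flat.trans A (C r) _

/-- Flatness is checked locally, where the ideal is free of rank one; finite presentation comes from
noetherianity. -/
lemma IsEffectiveCartier.projective [IsLocallyNoetherian X] {K : X.IdealSheafData}
    (hK : IsEffectiveCartier K) (U : X.affineOpens) :
    Module.Projective Γ(X, U.1) (K.ideal U) := by
  have : IsNoetherianRing Γ(X, U.1) := IsLocallyNoetherian.component_noetherian U
  choose f hf a ha hKa using fun p : U.1 => hK.exists_basicOpen U p p.2
  have hs : Ideal.span (Set.range f) = ⊤ := by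
    rw [← U.2.self_le_iSup_basicOpen_iff]
    exact fun p hp => TopologicalSpace.Opens.mem_iSup.mpr ⟨⟨_, ⟨p, hp⟩, rfl⟩, hf ⟨p, hp⟩⟩
  have inst := U.2.isLocalization_basicOpen
  have : Module.Flat Γ(X, U.1) (K.ideal U) := by
    refine flat_of_locally_span_singleton (K.ideal U) _ hs (fun r => Γ(X, X.basicOpen r.1)) ?_
    rintro ⟨_, p, rfl⟩
    refine ⟨a p, ha p, ?_⟩
    rw [← hKa p, ← K.map_ideal_basicOpen]
    rfl
  have : Module.FinitePresentation Γ(X, U.1) (K.ideal U) :=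
    Module.finitePresentation_of_finite _ _
  exact Module.Flat.projective_of_finitePresentation

lemma le_ker_quotient_fromSpec {E : X.IdealSheafData} {U : X.Opens} (hU : IsAffineOpen U)
    (P : Ideal Γ(X, U)) (h : E.ideal ⟨U, hU⟩ ≤ P) :
    E ≤ (Spec.map (CommRingCat.ofHom (Ideal.Quotient.mk P)) ≫ hU.fromSpec).ker := by
  refine le_ker_of_comap_eq_bot _ _ (le_bot_iff.1 ?_)
  rw [← specIdeal_le_iff, Scheme.IdealSheafData.comap_comp, specIdeal_comap,
    specIdeal_comap_fromSpec, Ideal.map_le_iff_le_comap]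
  intro x hx
  have : CommRingCat.ofHom (Ideal.Quotient.mk P) x = 0 := Ideal.Quotient.eq_zero_iff_mem.2 (h hx)
  rw [Ideal.mem_comap]
  exact this ▸ zero_mem _

variable {f : X ⟶ Y} {IY IZ : Y.IdealSheafData}

lemma totalTransform_le_weakTransform :
    totalTransform f IZ ≤ weakTransform f IY IZ := le_residual _ _

variable [IsLocallyNoetherian X]

lemma mem_strictTransform_iff (U : X.affineOpens) (a : Γ(X, U.1))
    (hE : (exceptional f IY).ideal U = Ideal.span {a}) (x : Γ(X, U.1)) :
    x ∈ (strictTransform f IY IZ).ideal U ↔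
      ∃ n : ℕ, a ^ n * x ∈ (totalTransform f IZ).ideal U :=
  mem_ideal_ker_compl_iff _ _ U a hE x

lemma mem_strictTransform_of_mul_mem (U : X.affineOpens) (a : Γ(X, U.1))
    (hE : (exceptional f IY).ideal U = Ideal.span {a}) (x : Γ(X, U.1)) (n : ℕ)
    (h : a ^ n * x ∈ (strictTransform f IY IZ).ideal U) :
    x ∈ (strictTransform f IY IZ).ideal U := by
  rw [mem_strictTransform_iff U a hE] at h ⊢
  obtain ⟨m, hm⟩ := h
  exact ⟨m + n, by rwa [pow_add, mul_assoc]⟩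

/-- Saturation on an arbitrary affine open: the one in `IsAssociatedPrimeCycle` need not trivialize
`E`. -/
lemma mem_strictTransform_of_forall_mul_mem (hY : IsEffectiveCartier (exceptional f IY))
    (U : X.affineOpens) (x : Γ(X, U.1))
    (h : ∀ e ∈ (exceptional f IY).ideal U, e * x ∈ (strictTransform f IY IZ).ideal U) :
    x ∈ (strictTransform f IY IZ).ideal U := by
  refine mem_ideal_of_locally _ U x fun p hp => ?_
  obtain ⟨g, hg, a, -, ha⟩ := hY.exists_basicOpen U p hp
  refine ⟨g, hg, mem_strictTransform_of_mul_mem _ a ha _ 1 ?_⟩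
  set y := X.presheaf.map (homOfLE (X.basicOpen_le g)).op x
  have hle : (exceptional f IY).ideal (X.affineBasicOpen g) ≤
      Submodule.comap (LinearMap.mulRight Γ(X, X.basicOpen g) y)
        ((strictTransform f IY IZ).ideal (X.affineBasicOpen g)) := by
    rw [← Scheme.IdealSheafData.map_ideal_basicOpen]
    refine Ideal.map_le_iff_le_comap.2 fun e he => ?_
    have := Scheme.IdealSheafData.ideal_le_comap_ideal _
      (show X.affineBasicOpen g ≤ U from X.basicOpen_le g) (h e he)
    rw [Ideal.mem_comap, map_mul] at this
    exact this
  have hay : a * y ∈ (strictTransform f IY IZ).ideal (X.affineBasicOpen g) :=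
    hle (ha ▸ Ideal.mem_span_singleton_self a)
  exact (pow_one a).symm ▸ hay

lemma weakTransform_le_strictTransform (hY : IsEffectiveCartier (exceptional f IY)) :
    weakTransform f IY IZ ≤ strictTransform f IY IZ := by
  obtain ⟨U, hU, h⟩ := hY.exists_cover
  refine Scheme.IdealSheafData.le_of_iSup_eq_top U hU fun p x hx => ?_
  obtain ⟨a, -, ha⟩ := h p
  rw [mem_strictTransform_iff (U p) a ha]
  refine ⟨(orderAlong IY IZ).toNat, ?_⟩
  rw [mul_comm]
  refine residual_mul_le _ _ (U p) (Ideal.mul_mem_mul hx ?_)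
  exact Ideal.pow_mem_pow (ha ▸ Ideal.mem_span_singleton_self a) _

/-- If `a ^ l * y` lies in the strict ideal, so does `y`, by saturation. -/
lemma strictTransform_inf_pow_le (hY : IsEffectiveCartier (exceptional f IY)) (l : ℕ) :
    strictTransform f IY IZ ⊓ exceptional f IY ^ l ≤
      strictTransform f IY IZ * exceptional f IY ^ l := by
  obtain ⟨U, hU, h⟩ := hY.exists_cover
  refine Scheme.IdealSheafData.le_of_iSup_eq_top U hU fun p x hx => ?_
  obtain ⟨a, -, ha⟩ := h p
  obtain ⟨hx1, hx2⟩ := hx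
  have hal : (exceptional f IY ^ l).ideal (U p) = Ideal.span {a ^ l} := by
    rw [Scheme.IdealSheafData.ideal_pow, Pi.pow_apply, ha, Ideal.span_singleton_pow]
  rw [SetLike.mem_coe, hal] at hx2
  obtain ⟨y, rfl⟩ := Ideal.mem_span_singleton.1 hx2
  rw [Scheme.IdealSheafData.ideal_mul, Pi.mul_apply, hal, mul_comm (a ^ l)]
  exact Ideal.mul_mem_mul (mem_strictTransform_of_mul_mem (U p) a ha y l hx1)
    (Ideal.mem_span_singleton_self _)

theorem torIndependent_strictTransform (hY : IsEffectiveCartier (exceptional f IY)) (l : ℕ) :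
    TorIndependent (strictTransform f IY IZ) (exceptional f IY ^ l) := by
  intro U j hj
  have := (hY.pow l).projective U
  exact isZero_tor_quotient _ _ (strictTransform_inf_pow_le hY l U) j hj

lemma not_exceptional_le_of_isAssociatedPrimeCycle (hY : IsEffectiveCartier (exceptional f IY))
    (IV : X.IdealSheafData) (hV : IsAssociatedPrimeCycle IV (strictTransform f IY IZ)) :
    ¬ exceptional f IY ≤ IV := by
  obtain ⟨-, U, hU, φ, hφ⟩ := hV
  intro hle
  -- If `E` contained `V`, its ideal would kill `φ 1`, forcing `φ 1 = 0` by saturation.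
  obtain ⟨x, hx⟩ := Ideal.Quotient.mk_surjective (φ 1)
  have hxS : x ∈ (strictTransform f IY IZ).ideal U := by
    refine mem_strictTransform_of_forall_mul_mem hY U x fun e he => ?_
    rw [← Ideal.Quotient.eq_zero_iff_mem, map_mul, hx]
    have : e • (1 : Γ(X, U.1) ⧸ IV.ideal U) = 0 := by
      rw [Algebra.smul_def, mul_one]
      exact Ideal.Quotient.eq_zero_iff_mem.2 (hle U he)
    have h2 := congrArg φ this
    rw [map_smul, map_zero, Algebra.smul_def] at h2
    exact h2
  rw [Ideal.Quotient.eq_zero_iff_mem.2 hxS] at hx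
  have h1 : (1 : Γ(X, U.1) ⧸ IV.ideal U) = 0 := hφ (by rw [map_zero, hx])
  exact hU ((Ideal.eq_top_iff_one _).2 (Ideal.Quotient.eq_zero_iff_mem.1 h1))

/-- The cycle is the closure in `X` of `Spec` of the quotient by `P`; its ideal over `U` is again
`P`. -/
lemma isAssociatedPrimeCycle_ker {J : X.IdealSheafData} {U : X.Opens} (hU : IsAffineOpen U)
    (P : Ideal Γ(X, U)) (hP : IsAssociatedPrime P (Γ(X, U) ⧸ J.ideal ⟨U, hU⟩)) :
    IsAssociatedPrimeCycle
      (Spec.map (CommRingCat.ofHom (Ideal.Quotient.mk P)) ≫ hU.fromSpec).ker J := by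
  have : IsNoetherianRing Γ(X, U) := IsLocallyNoetherian.component_noetherian ⟨U, hU⟩
  rw [isAssociatedPrime_iff_exists_injective_linearMap] at hP
  have := hP.1
  refine ⟨isIntegral_subscheme_ker _, ⟨U, hU⟩, ?_, ?_⟩
  · rw [ideal_ker_quotient_fromSpec]
    exact hP.1.ne_top
  · rw [ideal_ker_quotient_fromSpec]
    exact hP.2

lemma strictTransform_le_weakTransform (hY : IsEffectiveCartier (exceptional f IY))
    (h : ∀ IV : X.IdealSheafData, IsAssociatedPrimeCycle IV (weakTransform f IY IZ) →
      ¬ exceptional f IY ≤ IV) :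
    strictTransform f IY IZ ≤ weakTransform f IY IZ := by
  obtain ⟨U, hU, hE⟩ := hY.exists_cover
  refine Scheme.IdealSheafData.le_of_iSup_eq_top U hU fun p x hx => ?_
  obtain ⟨a, -, ha⟩ := hE p
  obtain ⟨n, hn⟩ := (mem_strictTransform_iff (U p) a ha x).1 hx
  by_contra hxJ
  have : IsNoetherianRing Γ(X, (U p).1) := IsLocallyNoetherian.component_noetherian (U p)
  obtain ⟨P, hP, hle⟩ := exists_le_isAssociatedPrime_of_isNoetherianRing Γ(X, (U p).1)
    (Ideal.Quotient.mk ((weakTransform f IY IZ).ideal (U p)) x)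
    (fun h0 => hxJ (Ideal.Quotient.eq_zero_iff_mem.1 h0))
  -- `a ^ n * x` lies in the total ideal, hence in the weak one, so `a ^ n` annihilates the class of
  -- `x`.
  have han : a ^ n ∈ P := by
    refine hle (Submodule.mem_colon_singleton.2 ((Submodule.mem_bot _).2 ?_))
    exact Ideal.Quotient.eq_zero_iff_mem.2 (totalTransform_le_weakTransform (IY := IY) (U p) hn)
  have haP : a ∈ P := hP.isPrime.mem_of_pow_mem n han
  refine h _ (isAssociatedPrimeCycle_ker (U p).2 P hP) (le_ker_quotient_fromSpec (U p).2 P ?_)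
  exact ha.le.trans ((Ideal.span_singleton_le_iff_mem _).2 haP)

end Main
end BlowupTransforms

open AlgebraicGeometry BlowupTransforms
theorem mainTheorem7 {M B : Scheme.{0}} (s : M ⟶ Spec (CommRingCat.of ℂ))
    [Smooth s] [IsSeparated s] [QuasiCompact s]
    (IY IZ : M.IdealSheafData) [Smooth (IY.subschemeι ≫ s)]
    (f : B ⟶ M) (hf : IsBlowup f IY) :
    (weakTransform f IY IZ = strictTransform f IY IZ ↔
      ∀ IV : B.IdealSheafData, IsAssociatedPrimeCycle IV (weakTransform f IY IZ) →
        ¬ exceptional f IY ≤ IV) ∧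
    (weakTransform f IY IZ = strictTransform f IY IZ →
      ∀ l : ℕ, 0 < l →
        TorIndependent (strictTransform f IY IZ) (exceptional f IY ^ l)) := by
  have : IsNoetherianRing (CommRingCat.of ℂ) := inferInstanceAs (IsNoetherianRing ℂ)
  have : IsLocallyNoetherian M := LocallyOfFiniteType.isLocallyNoetherian s
  have : IsLocallyNoetherian B := hf.isLocallyNoetherian
  have hE : IsEffectiveCartier (exceptional f IY) := hf.isEffectiveCartier
  refine ⟨⟨fun h IV hV => ?_, fun h => ?_⟩, fun _ l _ => torIndependent_strictTransform hE l⟩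
  · exact not_exceptional_le_of_isAssociatedPrimeCycle hE IV (h ▸ hV)
  · exact le_antisymm (weakTransform_le_strictTransform hE)
      (strictTransform_le_weakTransform hE h)
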